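/- For an integer $n\ge 2$ let $P_n$ be the set of squarefree integers $k$ with $2\le k\le n$, partially ordered by divisibility. For a finite nonempty poset $P$ let $\overline{N_i}(P)$ be the set of strict chains $x_0<x_1<\dots<x_i$ in $P$, let $\dim P$ be the greatest $i$ with $\overline{N_i}(P)\neq\emptyset$, and let $\chi(P)=\sum_{i=0}^{\dim P}(-1)^i\,\#\overline{N_i}(P)$. Put $d_n=\dim P_n$. For $i,d\ge 0$ let $f_{i,d}$ be the number of strictly increasing (for inclusion) sequences $A_0\subsetneq A_1\subsetneq\dots\subsetneq A_i$ of nonempty subsets of a fixed $(d+1)$-element set whose last term $A_i$ is the whole set (equivalently, the number of strict chains of length $i$, in the barycentric subdivision of a finite poset, that end in a given strict chain of length $d$). Put $F_{d,d}=1$, and for $0\le i<d$ put $$F_{i,d}=\sum_{\ell\ge 0}\ \sum_{i=i_0<i_1<\dots<i_\ell<i_{\ell+1}=d}\ \prod_{k=0}^{\ell}\frac{f_{i_k,i_{k+1}}}{(d+1)!-(i_k+1)!}.$$ Let $F_d(s)=\sum_{i=0}^{d}F_{i,d}\,s^{d-i}$ and let $H_{i,d}$ be the coefficient of $(s+1)^i$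 in the Taylor expansion of $F_d(s)$ at $s=-1$. For every $n$ with $\chi(P_n)\ne 0$ let $$\alpha_n=\frac{H_{1,d_n}\cdot\#\overline{N_{d_n}}(P_n)}{\chi(P_n)}.$$ Proposition. Assume that $\alpha_n\gg \frac{1}{(d_n+1)!}$, in the sense that there is a constant $c>0$ such that $|\alpha_n|\ge \frac{c}{(d_n+1)!}$ for all sufficiently large $n$ with $\chi(P_n)\neq 0$. Then there is a constant $A>0$ such that, as $n\to\infty$, $$\chi(P_n)=O\left(n\exp\left(-A\,\frac{\log n\,\log\log\log n}{\log\log n}\right)\right).$$ -/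

import Mathlib

open Filter Asymptotics

namespace ZetaPoset

/-- The set `N̄_i(P)` of chains `x_0 < x_1 < ⋯ < x_i` of length `i` in a poset `P`. -/
def StrictChain (P : Type*) [PartialOrder P] (i : ℕ) : Type _ :=
  {c : Fin (i + 1) → P // StrictMono c}

/-- The number `#N̄_i(P)` (used for finite `P` only). -/
noncomputable def numChains (P : Type*) [PartialOrder P] (i : ℕ) : ℕ :=
  Nat.card (StrictChain P i)

/-- The dimension of a finite nonempty poset: the greatest `i` such that there is a strict
chain of length `i`. -/
noncomputable def dim (P : Type*) [PartialOrder P] : ℕ :=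
  sSup {i : ℕ | Nonempty (StrictChain P i)}

/-- The Euler characteristic of a finite poset, `∑_{i ≤ dim P} (-1)^i #N̄_i(P)`. -/
noncomputable def eulerChar (P : Type*) [PartialOrder P] : ℤ :=
  ∑ i ∈ Finset.range (dim P + 1), (-1) ^ i * (numChains P i : ℤ)

/-- The barycentric subdivision of a poset: its nonempty finite chains, regarded as totally
ordered subsets and ordered by inclusion. -/
def Sd (P : Type*) [PartialOrder P] : Type _ :=
  {s : Finset P // s.Nonempty ∧ IsChain (· ≤ ·) (s : Set P)}

instance (P : Type*) [PartialOrder P] : PartialOrder (Sd P) :=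
  inferInstanceAs (PartialOrder {s : Finset P // s.Nonempty ∧ IsChain (· ≤ ·) (s : Set P)})

/-- The number `f_{i,d}` of strict chains of length `i` in a barycentric subdivision whose last
element is a given strict chain of length `d`. As this does not depend on the ambient poset or
on the given chain, the latter is taken to be the chain `0 < 1 < ⋯ < d` in `Fin (d + 1)`. -/
noncomputable def f (i d : ℕ) : ℕ :=
  Nat.card {c : StrictChain (Sd (Fin (d + 1))) i // (c.1 (Fin.last i)).1 = Finset.univ}

open Classical in
/-- The rational number `F_{i,d}` for `0 ≤ i ≤ d`: `F_{d,d} = 1` and, for `i < d`,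
`F_{i,d} = ∑ ∏_{k=0}^{ℓ} f_{i_k, i_{k+1}} / ((d+1)! - (i_k+1)!)`, where the sum is over all `ℓ ≥ 0`
and all sequences `i = i_0 < i_1 < ⋯ < i_ℓ < i_{ℓ+1} = d`. -/
noncomputable def F (i d : ℕ) : ℚ :=
  if i = d then 1
  else ∑ l ∈ Finset.range d,
    ∑ x ∈ Finset.univ.filter (fun x : Fin (l + 2) → Fin (d + 1) =>
        StrictMono x ∧ (x 0).val = i ∧ (x (Fin.last (l + 1))).val = d),
      ∏ k : Fin (l + 1), (f (x k.castSucc).val (x k.succ).val : ℚ) /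
        (((d + 1).factorial : ℚ) - (((x k.castSucc).val + 1).factorial : ℚ))

/-- The `F`-polynomial `F_d(s) = ∑_{i=-1}^{d} F_{i,d} s^{d-i}`; the term `i = -1` is absent
because `F_{-1,d} = 0`. -/
noncomputable def FPoly (d : ℕ) : Polynomial ℚ :=
  ∑ i ∈ Finset.range (d + 1), Polynomial.C (F i d) * Polynomial.X ^ (d - i)

/-- The rational number `H_{i,d}`: the coefficient of `(s+1)^i` in the Taylor expansion of
`F_d(s)` at `s = -1`. -/
noncomputable def H (i d : ℕ) : ℚ :=
  (Polynomial.taylor (-1) (FPoly d)).coeff i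

/-- The set underlying the poset `P_n`: squarefree integers `2 ≤ k ≤ n`. -/
def SqfreePoset (n : ℕ) : Type :=
  {k : ℕ // Squarefree k ∧ 2 ≤ k ∧ k ≤ n}

/-- `P_n` is ordered by divisibility. -/
instance (n : ℕ) : PartialOrder (SqfreePoset n) where
  le a b := a.1 ∣ b.1
  le_refl a := dvd_refl a.1
  le_trans _ _ _ hab hbc := dvd_trans hab hbc
  le_antisymm _ _ hab hba := Subtype.ext (Nat.dvd_antisymm hab hba)

instance (n : ℕ) : Finite (SqfreePoset n) :=
  ((Set.finite_Iic n).subset (fun _ hk => hk.2.2) :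
    {k : ℕ | Squarefree k ∧ 2 ≤ k ∧ k ≤ n}.Finite).to_subtype

/-- `χ(P_n)`. -/
noncomputable def chi (n : ℕ) : ℤ := eulerChar (SqfreePoset n)

/-- `d_n = dim P_n`. -/
noncomputable def dimP (n : ℕ) : ℕ := dim (SqfreePoset n)

/-- `α_n = H_{1,d_n} · #N̄_{d_n}(P_n) / χ(P_n)`, meaningful when `χ(P_n) ≠ 0`. -/
noncomputable def alpha (n : ℕ) : ℚ :=
  H 1 (dimP n) * (numChains (SqfreePoset n) (dimP n) : ℚ) / (chi n : ℚ)

end ZetaPoset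

/-! By definition `α_n χ(P_n) = H_{1,d} · #N̄_d(P_n)` with `d = d_n`, so the hypothesis turns upper
bounds for the two factors on the right into one for `χ(P_n)`. Put `D = d + 1`.

The first factor: `(F_{i,d})_i` is an eigenvector of the matrix `f` with eigenvalue `D!`
(`factorial_mul_F`). Pairing it with `(-1)^k` gives `F_d(-1) = 0`. Pairing it with `k(-1)^k`
expresses `D! · H_{1,d}`, up to sign, as the sum of `((-2)^(j+1) - (-1)^(j+1)) F_{j,d}`. With
`F_{j,d} ≤ C(D, j+1)` (`F_le_choose`) this gives `|H_{1,d}| ≤ 2·3^D / D!` (`abs_H_one_le`).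

The second factor: chains of maximal length end at integers with exactly `D` prime factors, and each
such integer ends `D!` of them. If `K` is the number of these integers, `|χ(P_n)| ≤ (2/c) 3^D D! K`.
Rankin's method with parameter `(D log D)^2`, Chebyshev's estimates for the `j`-th prime, and the
fact that `n` is less than the product of the first `D + 1` primes bound `D! K` by `n` times an
exponential in `D`, divided by a product of `D` logarithms (`factorial_mul_rankin_le`). That product
has logarithm at least about `(D/2) log log D`, which beats the exponential. Finally `log n ≪ D log
D` converts the saving into one in `n`. -/

namespace ZetaPoset

/-! ### Chains sorted by their last element -/

/-- The number of strict chains of length `i` ending at `a`. -/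
noncomputable def numChainsTo {P : Type*} [PartialOrder P] (i : ℕ) (a : P) : ℕ :=
  Nat.card {c : StrictChain P i // c.1 (Fin.last i) = a}

instance {P : Type*} [PartialOrder P] [Finite P] (i : ℕ) : Finite (StrictChain P i) :=
  inferInstanceAs (Finite {c : Fin (i + 1) → P // StrictMono c})

lemma numChainsTo_zero {P : Type*} [PartialOrder P] (a : P) : numChainsTo 0 a = 1 := by
  unfold numChainsTo
  rw [Nat.card_eq_one_iff_unique]
  have h1 : Subsingleton (Fin (0 + 1)) := inferInstanceAs (Subsingleton (Fin 1))
  refine ⟨⟨fun c c' => ?_⟩, ⟨⟨⟨fun _ => a, Subsingleton.strictMono _⟩, rfl⟩⟩⟩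
  apply Subtype.ext
  apply Subtype.ext
  funext k
  rw [Subsingleton.elim k (Fin.last 0), c.2, c'.2]

/-- Removing the last element of a chain. -/
def chainSuccEquiv {P : Type*} [PartialOrder P] (i : ℕ) (a : P) :
    {c : StrictChain P (i + 1) // c.1 (Fin.last (i + 1)) = a} ≃
      Σ b : {b : P // b < a}, {c : StrictChain P i // c.1 (Fin.last i) = b.1} where
  toFun c := ⟨⟨c.1.1 (Fin.last i).castSucc, by
      have := c.1.2 (Fin.castSucc_lt_last (Fin.last i))
      rwa [c.2] at this⟩,
    ⟨⟨fun k => c.1.1 k.castSucc, c.1.2.comp (Fin.strictMono_castSucc)⟩, rfl⟩⟩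
  invFun s := ⟨⟨Fin.snoc (α := fun _ => P) s.2.1.1 a, by
      refine Fin.strictMono_iff_lt_succ.2 fun k => ?_
      rw [Fin.snoc_castSucc]
      induction k using Fin.lastCases with
      | last =>
        rw [Fin.succ_last, Fin.snoc_last, s.2.2]
        exact s.1.2
      | cast k =>
        rw [Fin.succ_castSucc, Fin.snoc_castSucc]
        exact s.2.1.2 (Fin.castSucc_lt_succ)⟩, by simp⟩
  left_inv c := by
    apply Subtype.ext
    apply Subtype.ext
    funext k
    induction k using Fin.lastCases with
    | last => simp [c.2]
    | cast k => simp
  right_inv s := by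
    obtain ⟨⟨b, hb⟩, ⟨c, hc⟩⟩ := s
    simp only at hc
    subst hc
    simp only [Fin.snoc_castSucc]
    rw! (castMode := .all) [Fin.snoc_castSucc]
    rfl

lemma numChainsTo_succ {P : Type*} [PartialOrder P] [Fintype P] [DecidableLT P] (i : ℕ) (a : P) :
    numChainsTo (i + 1) a = ∑ b ∈ Finset.univ.filter (· < a), numChainsTo i b := by
  unfold numChainsTo
  rw [Nat.card_congr (chainSuccEquiv i a), Nat.card_sigma]
  exact (Finset.sum_subtype (p := fun b => b < a) (Finset.univ.filter (· < a)) (by simp)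
    (fun b => Nat.card {c : StrictChain P i // c.1 (Fin.last i) = b})).symm

/-! ### Chains of finite sets: alternating sums and bounds -/

/-- The number of strictly increasing sequences `∅ = A_0 ⊂ A_1 ⊂ ⋯ ⊂ A_k` of sets ending in a
given set of `m` elements. -/
def setChains : ℕ → ℕ → ℕ
  | 0, m => if m = 0 then 1 else 0
  | k + 1, m => ∑ j ∈ Finset.range m, m.choose j * setChains k j

lemma setChains_succ (k m : ℕ) :
    setChains (k + 1) m = ∑ j ∈ Finset.range m, m.choose j * setChains k j := rfl

lemma setChains_one (m : ℕ) : setChains 1 (m + 1) = 1 := by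
  rw [setChains_succ, Finset.sum_eq_single 0] <;> simp [setChains]
  intro b _ hb h; exact absurd h hb

lemma setChains_eq_zero {k m : ℕ} (h : m < k) : setChains k m = 0 := by
  induction k generalizing m with
  | zero => omega
  | succ k ih =>
    rw [setChains_succ]
    refine Finset.sum_eq_zero fun j hj => ?_
    rw [ih (by have := Finset.mem_range.1 hj; omega), mul_zero]

lemma setChains_self (k : ℕ) : setChains k k = k.factorial := by
  induction k with
  | zero => rfl
  | succ k ih =>
    rw [setChains_succ, Finset.sum_range_succ, Finset.sum_eq_zero, ih, Nat.choose_succ_self_right,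
      zero_add, Nat.factorial_succ]
    intro j hj
    rw [setChains_eq_zero (Finset.mem_range.1 hj), mul_zero]

lemma sum_range_eq_of_le {m N : ℕ} (h : m ≤ N) (w : ℕ → ℤ) :
    ∑ k ∈ Finset.range (N + 1), w k * (setChains k m : ℤ) =
      ∑ k ∈ Finset.range (m + 1), w k * (setChains k m : ℤ) := by
  refine (Finset.sum_subset (Finset.range_mono (by omega)) fun k _ hk => ?_).symm
  rw [setChains_eq_zero (by simpa using hk)]
  simp

lemma sum_choose_mul_pow (m : ℕ) (x : ℤ) :
    ∑ j ∈ Finset.range m, (m.choose j : ℤ) * x ^ j = (x + 1) ^ m - x ^ m := by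
  rw [add_pow, Finset.sum_range_succ]
  simp [mul_comm]

/-- In `m`, the exponential generating function of `setChains k m` is `(e^x - 1)^k`, and `∑ (-1)^k
(e^x - 1)^k = e^(-x)`. The induction is the same computation through the recursion and the binomial
theorem. -/
lemma sum_neg_one_pow_setChains (m : ℕ) :
    ∑ k ∈ Finset.range (m + 1), (-1) ^ k * (setChains k m : ℤ) = (-1) ^ m := by
  induction m using Nat.strong_induction_on with
  | _ m ih =>
    rcases Nat.eq_zero_or_pos m with rfl | hm
    · simp [setChains]
    rw [Finset.sum_range_succ']
    have h0 : setChains 0 m = 0 := by simp [setChains, hm.ne']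
    simp only [setChains_succ, h0]
    push_cast
    have : ∀ k, (-1 : ℤ) ^ (k + 1) * ∑ j ∈ Finset.range m, (m.choose j : ℤ) * setChains k j =
        ∑ j ∈ Finset.range m, -((m.choose j : ℤ) * ((-1) ^ k * setChains k j)) := by
      intro k; rw [Finset.mul_sum]; exact Finset.sum_congr rfl fun j _ => by ring
    simp only [this]
    rw [Finset.sum_comm]
    have : ∀ j ∈ Finset.range m,
        ∑ k ∈ Finset.range m, -((m.choose j : ℤ) * ((-1) ^ k * setChains k j)) =
          -((m.choose j : ℤ) * (-1) ^ j) := by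
      intro j hj
      have hj' := Finset.mem_range.1 hj
      rw [Finset.sum_neg_distrib, ← Finset.mul_sum]
      have := sum_range_eq_of_le (N := m - 1) (m := j) (by omega) (fun k => (-1) ^ k)
      rw [Nat.sub_add_cancel hm] at this
      rw [this, ih j hj']
    rw [Finset.sum_congr rfl this, Finset.sum_neg_distrib, sum_choose_mul_pow]
    simp [hm.ne']

/-- With `t = 1 - e^x` the generating function is `∑ k t^k = t / (1 - t)^2 = e^(-2x) - e^(-x)`. -/
lemma sum_mul_neg_one_pow_setChains (m : ℕ) :
    ∑ k ∈ Finset.range (m + 1), (k * (-1) ^ k) * (setChains k m : ℤ) = (-2) ^ m - (-1) ^ m := by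
  induction m using Nat.strong_induction_on with
  | _ m ih =>
    rcases Nat.eq_zero_or_pos m with rfl | hm
    · simp
    rw [Finset.sum_range_succ']
    have h0 : setChains 0 m = 0 := by simp [setChains, hm.ne']
    simp only [setChains_succ, h0]
    push_cast
    have : ∀ k : ℕ, ((k : ℤ) + 1) * (-1 : ℤ) ^ (k + 1) *
        ∑ j ∈ Finset.range m, (m.choose j : ℤ) * setChains k j =
        ∑ j ∈ Finset.range m, -(((m.choose j : ℤ) * ((k * (-1) ^ k) * setChains k j)) +
          (m.choose j : ℤ) * ((-1) ^ k * setChains k j)) := by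
      intro k; rw [Finset.mul_sum]; exact Finset.sum_congr rfl fun j _ => by ring
    simp only [this]
    rw [Finset.sum_comm]
    have : ∀ j ∈ Finset.range m,
        ∑ k ∈ Finset.range m, -(((m.choose j : ℤ) * ((k * (-1) ^ k) * setChains k j)) +
          (m.choose j : ℤ) * ((-1) ^ k * setChains k j)) =
          -((m.choose j : ℤ) * (-2) ^ j) := by
      intro j hj
      have hj' := Finset.mem_range.1 hj
      rw [Finset.sum_neg_distrib, Finset.sum_add_distrib, ← Finset.mul_sum, ← Finset.mul_sum]
      have h1 := sum_range_eq_of_le (N := m - 1) (m := j) (by omega) (fun k => (-1) ^ k)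
      have h2 := sum_range_eq_of_le (N := m - 1) (m := j) (by omega)
        (fun k => k * (-1) ^ k)
      rw [Nat.sub_add_cancel hm] at h1 h2
      rw [h1, h2, ih j hj', sum_neg_one_pow_setChains]
      ring
    rw [Finset.sum_congr rfl this, Finset.sum_neg_distrib, sum_choose_mul_pow]
    norm_num

lemma sum_range_choose_eq (m k : ℕ) : ∑ j ∈ Finset.range m, j.choose k = m.choose (k + 1) := by
  induction m with
  | zero => simp
  | succ m ih => rw [Finset.sum_range_succ, ih, Nat.choose_succ_succ, add_comm]

/-- Every chain from `∅` refines to a complete flag, so it is determined by an ordering of the `m +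
1` elements and the sizes of its `k` intermediate sets. -/
lemma setChains_le (k m : ℕ) :
    setChains (k + 1) (m + 1) ≤ (m + 1).factorial * m.choose k := by
  induction k generalizing m with
  | zero => rw [setChains_one]; simpa using Nat.succ_le_of_lt (Nat.factorial_pos (m + 1))
  | succ k ih =>
    rw [setChains_succ, Finset.sum_range_succ']
    have h0 : setChains (k + 1) 0 = 0 := setChains_eq_zero (by omega)
    rw [h0, mul_zero, add_zero]
    calc ∑ j ∈ Finset.range m, (m + 1).choose (j + 1) * setChains (k + 1) (j + 1)
        ≤ ∑ j ∈ Finset.range m, (m + 1).factorial * j.choose k := by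
          refine Finset.sum_le_sum fun j hj => ?_
          have hj' := Finset.mem_range.1 hj
          refine (Nat.mul_le_mul_left _ (ih j)).trans ?_
          rw [← mul_assoc]
          refine Nat.mul_le_mul_right _ ?_
          rw [← Nat.choose_mul_factorial_mul_factorial (show j + 1 ≤ m + 1 by omega)]
          exact Nat.le_mul_of_pos_right _ (Nat.factorial_pos _)
      _ = (m + 1).factorial * m.choose (k + 1) := by
          rw [← Finset.mul_sum, sum_range_choose_eq]

/-- The terms below the top form `setChains (k + 2) (m + 1)` by the recursion; the two bounds then
combine by Pascal's rule. This makes the binomial coefficients a supersolution of the recursion for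
`F`. -/
lemma sum_choose_mul_setChains_le (k m : ℕ) :
    ∑ j ∈ Finset.range (m + 2), (m + 1).choose j * setChains (k + 1) j ≤
      (m + 1).factorial * (m + 1).choose (k + 1) := by
  rw [Finset.sum_range_succ, ← setChains_succ, Nat.choose_self, one_mul, Nat.choose_succ_succ,
    mul_add, add_comm]
  exact add_le_add (setChains_le _ _) (setChains_le _ _)

/-! ### Posets of nonempty finite sets, and the numbers `f` -/

/-- Every nonempty subset of a linear order is a chain. -/
def sdEquiv (α : Type*) [LinearOrder α] : Sd α ≃ {s : Finset α // s.Nonempty} where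
  toFun s := ⟨s.1, s.2.1⟩
  invFun s := ⟨s.1, s.2, fun a _ b _ _ => le_total a b⟩
  left_inv _ := rfl
  right_inv _ := rfl

/-- If `P` is isomorphic to a family of nonempty finite sets, ordered by inclusion, which contains
all nonempty subsets of its members, then its chains are counted by `setChains`. -/
lemma numChainsTo_eq_setChains {P α : Type*} [PartialOrder P] [Finite P] [DecidableEq α]
    (φ : P → Finset α) (hlt : ∀ a b, b < a ↔ φ b ⊂ φ a) (hinj : Function.Injective φ)
    (hne : ∀ a, (φ a).Nonempty) (hsub : ∀ a t, t.Nonempty → t ⊆ φ a → ∃ b, φ b = t)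
    (i : ℕ) (a : P) : numChainsTo i a = setChains (i + 1) (φ a).card := by
  classical
  let _ : Fintype P := Fintype.ofFinite P
  induction i generalizing a with
  | zero =>
    obtain ⟨m, hm⟩ : ∃ m, (φ a).card = m + 1 :=
      ⟨(φ a).card - 1, by have := (hne a).card_pos; omega⟩
    rw [numChainsTo_zero, hm, setChains_one]
  | succ i ih =>
    rw [numChainsTo_succ, setChains_succ]
    have h1 : ∑ b ∈ Finset.univ.filter (· < a), numChainsTo i b =
        ∑ t ∈ (φ a).ssubsets, setChains (i + 1) t.card := by
      -- `setChains` counts steps starting from `∅`, which is not in the poset; hence the shift `i +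
      -- 1`, and the empty subset contributes nothing.
      have h2 : ∑ t ∈ (φ a).ssubsets, setChains (i + 1) t.card =
          ∑ t ∈ (φ a).ssubsets.filter (·.Nonempty), setChains (i + 1) t.card := by
        refine (Finset.sum_filter_of_ne fun t _ ht => ?_).symm
        by_contra h
        rw [Finset.not_nonempty_iff_eq_empty] at h
        subst h
        exact ht (setChains_eq_zero (by simp))
      rw [h2]
      refine Finset.sum_bij (fun b _ => φ b) ?_ ?_ ?_ ?_
      · intro b hb
        exact Finset.mem_filter.2
          ⟨Finset.mem_ssubsets.2 ((hlt a b).1 (Finset.mem_filter.1 hb).2), hne b⟩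
      · intro b _ b' _ h
        exact hinj h
      · intro t ht
        have ht' := Finset.mem_filter.1 ht
        have hta := Finset.mem_ssubsets.1 ht'.1
        obtain ⟨b, rfl⟩ := hsub a t ht'.2 hta.1
        exact ⟨b, Finset.mem_filter.2 ⟨Finset.mem_univ _, (hlt a b).2 hta⟩, rfl⟩
      · intro b _
        exact ih b
    rw [h1]
    have h3 := Finset.sum_powerset_apply_card (fun j => setChains (i + 1) j) (x := φ a)
    rw [Finset.sum_range_succ, Nat.choose_self, one_smul] at h3
    have h4 := Finset.sum_erase_add (φ a).powerset (fun t => setChains (i + 1) t.card)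
      (Finset.mem_powerset_self (φ a))
    rw [h3] at h4
    have h5 := Nat.add_right_cancel h4
    simpa [Finset.ssubsets] using h5

instance {α : Type*} [LinearOrder α] [Finite α] : Finite (Sd α) :=
  Finite.of_equiv _ (sdEquiv α).symm

lemma numChainsTo_sd {α : Type*} [LinearOrder α] [Finite α] (i : ℕ) (s : Sd α) :
    numChainsTo i s = setChains (i + 1) s.1.card :=
  numChainsTo_eq_setChains (fun s : Sd α => s.1) (fun _ _ => Iff.rfl) Subtype.val_injective
    (fun s => s.2.1) (fun _ t ht _ => ⟨(sdEquiv α).symm ⟨t, ht⟩, rfl⟩) i s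

lemma f_eq_setChains (i d : ℕ) : f i d = setChains (i + 1) (d + 1) := by
  have h := numChainsTo_sd i ((sdEquiv (Fin (d + 1))).symm ⟨Finset.univ, Finset.univ_nonempty⟩)
  have hc : ((sdEquiv (Fin (d + 1))).symm ⟨Finset.univ, Finset.univ_nonempty⟩).1.card = d + 1 :=
    Finset.card_fin _
  rw [hc] at h
  rw [← h]
  unfold f numChainsTo
  refine Nat.card_congr (Equiv.subtypeEquivRight fun c => ?_)
  exact ⟨fun h => Subtype.ext h, fun h => congrArg Subtype.val h⟩

/-! ### The numbers `F`: recursion, eigenvector equation, bounds -/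

open Classical in
/-- The part of the sum defining `F i d` that comes from the sequences of a given length. -/
noncomputable def pathSum (d l i : ℕ) : ℚ :=
  ∑ x ∈ Finset.univ.filter (fun x : Fin (l + 2) → Fin (d + 1) =>
        StrictMono x ∧ (x 0).val = i ∧ (x (Fin.last (l + 1))).val = d),
      ∏ k : Fin (l + 1), (f (x k.castSucc).val (x k.succ).val : ℚ) /
        (((d + 1).factorial : ℚ) - (((x k.castSucc).val + 1).factorial : ℚ))

lemma F_eq_sum_pathSum {i d : ℕ} (h : i ≠ d) : F i d = ∑ l ∈ Finset.range d, pathSum d l i := by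
  rw [F, if_neg h]
  rfl

lemma pathSum_eq_zero {d l i : ℕ} (h : d < i + l + 1) : pathSum d l i = 0 := by
  classical
  rw [pathSum]
  refine Finset.sum_eq_zero fun x hx => ?_
  exfalso
  obtain ⟨hx, h0, hl⟩ := (Finset.mem_filter.1 hx).2
  have key : ∀ k : Fin (l + 2), i + k.val ≤ (x k).val := by
    intro k
    induction k using Fin.induction with
    | zero => simp [h0]
    | succ k ih =>
      have := Fin.lt_def.1 (hx (Fin.castSucc_lt_succ (i := k)))
      simp only [Fin.val_castSucc, Fin.val_succ] at ih ⊢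
      omega
  have := key (Fin.last (l + 1))
  rw [hl] at this
  simp at this
  omega

lemma pathSum_zero {d i : ℕ} (h : i < d) :
    pathSum d 0 i = (f i d : ℚ) / (((d + 1).factorial : ℚ) - ((i + 1).factorial : ℚ)) := by
  classical
  rw [pathSum, Finset.sum_eq_single ![⟨i, by omega⟩, Fin.last d]]
  · simp
  · intro x hx hne
    exfalso
    obtain ⟨-, h0, hl⟩ := (Finset.mem_filter.1 hx).2
    apply hne
    funext k
    refine Fin.cases ?_ (fun k => ?_) k
    · exact Fin.ext h0
    · obtain rfl : k = 0 := Subsingleton.elim (α := Fin 1) _ _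
      exact Fin.ext hl
  · intro hx
    exfalso
    apply hx
    refine Finset.mem_filter.2 ⟨Finset.mem_univ _, ?_, rfl, rfl⟩
    refine Fin.strictMono_iff_lt_succ.2 fun k => ?_
    obtain rfl : k = 0 := Subsingleton.elim (α := Fin 1) _ _
    exact h

lemma pathSum_succ {d l i : ℕ} (h : i ≤ d) :
    pathSum d (l + 1) i = ∑ j ∈ Finset.Ioc i d,
      (f i j : ℚ) / (((d + 1).factorial : ℚ) - ((i + 1).factorial : ℚ)) * pathSum d l j := by
  classical
  have h1 : ∑ j ∈ Finset.Ioc i d,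
      (f i j : ℚ) / (((d + 1).factorial : ℚ) - ((i + 1).factorial : ℚ)) * pathSum d l j =
      ∑ j ∈ Finset.Ioc i d, ∑ x ∈ Finset.univ.filter (fun x : Fin (l + 2) → Fin (d + 1) =>
        StrictMono x ∧ (x 0).val = j ∧ (x (Fin.last (l + 1))).val = d),
      ((f i j : ℚ) / (((d + 1).factorial : ℚ) - ((i + 1).factorial : ℚ)) *
      ∏ k : Fin (l + 1), (f (x k.castSucc).val (x k.succ).val : ℚ) /
        (((d + 1).factorial : ℚ) - (((x k.castSucc).val + 1).factorial : ℚ))) :=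
    Finset.sum_congr rfl fun j _ => by rw [pathSum, Finset.mul_sum]
  rw [h1, Finset.sum_sigma', pathSum]
  refine Finset.sum_bij' (fun x _ => ⟨(x 1).val, Fin.tail x⟩)
    (fun s _ => Fin.cons (⟨i, by omega⟩ : Fin (d + 1)) s.2) ?_ ?_ ?_ ?_ ?_
  · intro x hx
    obtain ⟨hx, h0, hl⟩ := (Finset.mem_filter.1 hx).2
    have h01 := Fin.lt_def.1 (hx (show (0 : Fin (l + 3)) < 1 from Fin.zero_lt_one))
    simp only [Finset.mem_sigma, Finset.mem_Ioc, Finset.mem_filter, Finset.mem_univ, true_and]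
    refine ⟨⟨by omega, by omega⟩, hx.comp (Fin.strictMono_succ), rfl, hl⟩
  · rintro ⟨j, x⟩ hx
    simp only [Finset.mem_sigma, Finset.mem_Ioc, Finset.mem_filter, Finset.mem_univ,
      true_and] at hx ⊢
    obtain ⟨⟨hij, -⟩, hx, h0, hl⟩ := hx
    refine ⟨Fin.strictMono_iff_lt_succ.2 fun k => ?_, rfl, hl⟩
    refine Fin.cases ?_ (fun k => ?_) k
    · simp only [Fin.castSucc_zero, Fin.cons_zero, Fin.cons_succ]
      rw [Fin.lt_def, h0]
      exact hij
    · rw [← Fin.succ_castSucc, Fin.cons_succ, Fin.cons_succ]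
      exact hx (Fin.castSucc_lt_succ)
  · intro x hx
    obtain ⟨hx, h0, hl⟩ := (Finset.mem_filter.1 hx).2
    have : (⟨i, by omega⟩ : Fin (d + 1)) = x 0 := Fin.ext h0.symm
    simp only [this, Fin.cons_self_tail]
  · rintro ⟨j, x⟩ hx
    simp only [Finset.mem_sigma, Finset.mem_Ioc, Finset.mem_filter, Finset.mem_univ,
      true_and] at hx
    obtain ⟨-, -, h0, -⟩ := hx
    subst h0
    rfl
  · intro x hx
    obtain ⟨hx, h0, hl⟩ := (Finset.mem_filter.1 hx).2
    rw [Fin.prod_univ_succ]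
    subst h0
    rfl

lemma F_self (d : ℕ) : F d d = 1 := if_pos rfl

/-- The recursion for `F i d` obtained from the first step of the sequences. -/
lemma F_rec {i d : ℕ} (h : i < d) :
    F i d = ∑ j ∈ Finset.Ioc i d,
      (f i j : ℚ) / (((d + 1).factorial : ℚ) - ((i + 1).factorial : ℚ)) * F j d := by
  -- A sequence starting at `j > i ≥ 0` cannot have `d` steps, so the last value of `l` drops out
  -- and the ranges match after removing one step.
  have hF : ∀ j ∈ Finset.Ioo i d, F j d = ∑ l ∈ Finset.range (d - 1), pathSum d l j := by
    intro j hj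
    have hj' := Finset.mem_Ioo.1 hj
    rw [F_eq_sum_pathSum (by omega), show d = (d - 1) + 1 by omega, Finset.sum_range_succ,
      ← show d = (d - 1) + 1 by omega, pathSum_eq_zero (l := d - 1) (by omega), add_zero]
  have hd : d = (d - 1) + 1 := by omega
  have hI : Finset.Ioc i d = insert d (Finset.Ioo i d) := (Finset.Ioo_insert_right h).symm
  have h0 : F i d = ∑ l ∈ Finset.range (d - 1), pathSum d (l + 1) i + pathSum d 0 i := by
    rw [F_eq_sum_pathSum (by omega)]
    conv_lhs => rw [hd]
    rw [Finset.sum_range_succ', ← hd]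
  rw [h0, pathSum_zero h, hI, Finset.sum_insert (by simp), F_self, mul_one, add_comm]
  congr 1
  have h1 : ∑ j ∈ Finset.Ioo i d,
      (f i j : ℚ) / (((d + 1).factorial : ℚ) - ((i + 1).factorial : ℚ)) * F j d =
      ∑ j ∈ Finset.Ioo i d, ∑ l ∈ Finset.range (d - 1),
      (f i j : ℚ) / (((d + 1).factorial : ℚ) - ((i + 1).factorial : ℚ)) * pathSum d l j :=
    Finset.sum_congr rfl fun j hj => by rw [hF j hj, Finset.mul_sum]
  rw [h1, Finset.sum_comm]
  refine Finset.sum_congr rfl fun l _ => ?_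
  rw [pathSum_succ h.le, hI, Finset.sum_insert (by simp), pathSum_eq_zero (i := d) (by omega),
    mul_zero, zero_add]

lemma factorial_succ_sub_pos {i d : ℕ} (h : i < d) :
    (0 : ℚ) < ((d + 1).factorial : ℚ) - ((i + 1).factorial : ℚ) := by
  have : (i + 1).factorial < (d + 1).factorial := (Nat.factorial_lt (by omega)).2 (by omega)
  have : ((i + 1).factorial : ℚ) < ((d + 1).factorial : ℚ) := by exact_mod_cast this
  linarith

lemma f_self (d : ℕ) : f d d = (d + 1).factorial := by rw [f_eq_setChains, setChains_self]

/-- The vector `(F i d)_i` is an eigenvector of the matrix `f`. -/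
lemma factorial_mul_F {i d : ℕ} (h : i ≤ d) :
    ((d + 1).factorial : ℚ) * F i d = ∑ j ∈ Finset.range (d + 1), (f i j : ℚ) * F j d := by
  -- `f` is upper triangular with diagonal `(i + 1)!`; this diagonal term is what the denominators
  -- in `F` subtract.
  have h1 : ∑ j ∈ Finset.range (d + 1), (f i j : ℚ) * F j d =
      ∑ j ∈ insert i (Finset.Ioc i d), (f i j : ℚ) * F j d := by
    refine (Finset.sum_subset (fun j hj => ?_) fun j hj hj' => ?_).symm
    · simp only [Finset.mem_insert, Finset.mem_Ioc, Finset.mem_range] at hj ⊢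
      omega
    · simp only [Finset.mem_insert, Finset.mem_Ioc, Finset.mem_range] at hj hj'
      rw [f_eq_setChains, setChains_eq_zero (by omega)]
      simp
  rw [h1, Finset.sum_insert (by simp), f_self]
  rcases h.eq_or_lt with rfl | h
  · simp
  · have hp := factorial_succ_sub_pos h
    have h2 : ∑ j ∈ Finset.Ioc i d, (f i j : ℚ) * F j d =
        (((d + 1).factorial : ℚ) - ((i + 1).factorial : ℚ)) * F i d := by
      rw [F_rec h, Finset.mul_sum]
      refine Finset.sum_congr rfl fun j _ => ?_
      field_simp
    rw [h2]
    ring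

lemma F_nonneg {i d : ℕ} (h : i ≤ d) : 0 ≤ F i d := by
  induction hk : d - i using Nat.strong_induction_on generalizing i with
  | _ k ih =>
    rcases h.eq_or_lt with rfl | h
    · rw [F_self]; norm_num
    · rw [F_rec h]
      refine Finset.sum_nonneg fun j hj => ?_
      have hj' := Finset.mem_Ioc.1 hj
      exact mul_nonneg (div_nonneg (Nat.cast_nonneg _) (factorial_succ_sub_pos h).le)
        (ih (d - j) (by omega) hj'.2 rfl)

/-- Downward induction on `i`: the recursion has nonnegative coefficients, and the binomial
coefficients satisfy it with an inequality in the favourable direction. -/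
lemma F_le_choose {i d : ℕ} (h : i ≤ d) : F i d ≤ ((d + 1).choose (i + 1) : ℚ) := by
  induction hk : d - i using Nat.strong_induction_on generalizing i with
  | _ k ih =>
    rcases h.eq_or_lt with rfl | h
    · rw [F_self]; norm_num
    · have hp := factorial_succ_sub_pos h
      have h1 : ∑ j ∈ Finset.Ioc i d, (f i j : ℚ) * F j d ≤
          ∑ j ∈ Finset.Ioc i d, (f i j : ℚ) * ((d + 1).choose (j + 1) : ℚ) := by
        refine Finset.sum_le_sum fun j hj => ?_
        have hj' := Finset.mem_Ioc.1 hj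
        exact mul_le_mul_of_nonneg_left (ih (d - j) (by omega) hj'.2 rfl) (Nat.cast_nonneg _)
      have h2 : ∑ j ∈ Finset.Ioc i d, (f i j : ℚ) * F j d =
          (((d + 1).factorial : ℚ) - ((i + 1).factorial : ℚ)) * F i d := by
        rw [F_rec h, Finset.mul_sum]
        refine Finset.sum_congr rfl fun j _ => ?_
        field_simp
      have h3 : ∑ j ∈ Finset.Ioc i d, f i j * (d + 1).choose (j + 1) +
          (i + 1).factorial * (d + 1).choose (i + 1) ≤
          (d + 1).factorial * (d + 1).choose (i + 1) := by
        refine le_trans ?_ (sum_choose_mul_setChains_le i d)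
        rw [Finset.sum_range_succ', setChains_eq_zero (show 0 < i + 1 by omega), mul_zero,
          add_zero, ← setChains_self, ← f_eq_setChains, add_comm]
        rw [← Finset.sum_insert (f := fun j => f i j * (d + 1).choose (j + 1)) (by simp)]
        simp only [f_eq_setChains, mul_comm ((d + 1).choose _)]
        refine Finset.sum_le_sum_of_subset fun j hj => ?_
        simp only [Finset.mem_insert, Finset.mem_Ioc, Finset.mem_range] at hj ⊢
        omega
      have h3' : ∑ j ∈ Finset.Ioc i d, (f i j : ℚ) * ((d + 1).choose (j + 1) : ℚ) +
          ((i + 1).factorial : ℚ) * ((d + 1).choose (i + 1) : ℚ) ≤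
          ((d + 1).factorial : ℚ) * ((d + 1).choose (i + 1) : ℚ) := by exact_mod_cast h3
      rw [h2] at h1
      refine le_of_mul_le_mul_left ?_ hp
      linarith

/-- Pairing the eigenvector equation with a weight `w` moves the weight onto the columns of `f`,
where the alternating sums are explicit. -/
lemma factorial_mul_sum_F (d : ℕ) (w : ℕ → ℤ) :
    ((d + 1).factorial : ℚ) * ∑ i ∈ Finset.range (d + 1), (w (i + 1) : ℚ) * F i d =
      ∑ j ∈ Finset.range (d + 1),
        ((∑ k ∈ Finset.range (j + 2), w k * (setChains k (j + 1) : ℤ) : ℤ) : ℚ) * F j d := by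
  have h1 : ((d + 1).factorial : ℚ) * ∑ i ∈ Finset.range (d + 1), (w (i + 1) : ℚ) * F i d =
      ∑ i ∈ Finset.range (d + 1), ∑ j ∈ Finset.range (d + 1),
        (w (i + 1) : ℚ) * ((f i j : ℚ) * F j d) := by
    rw [Finset.mul_sum]
    refine Finset.sum_congr rfl fun i hi => ?_
    rw [← Finset.mul_sum, ← factorial_mul_F (by have := Finset.mem_range.1 hi; omega)]
    ring
  rw [h1, Finset.sum_comm]
  refine Finset.sum_congr rfl fun j hj => ?_
  have hj' := Finset.mem_range.1 hj
  rw [← sum_range_eq_of_le (N := d + 1) (by omega) w, Finset.sum_range_succ' _ (d + 1),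
    setChains.eq_1 (j + 1)]
  push_cast
  simp only [f_eq_setChains]
  rw [mul_zero, add_zero, Finset.sum_mul]
  exact Finset.sum_congr rfl fun i _ => by ring

/-- The weight `(-1)^k` is a left eigenvector of eigenvalue `1`, and `(d + 1)! ≠ 1` when `d ≥ 1`, so
the pairing vanishes. Up to sign it is `F_d(-1)`. -/
lemma sum_neg_one_pow_mul_F {d : ℕ} (hd : 1 ≤ d) :
    ∑ i ∈ Finset.range (d + 1), (-1 : ℚ) ^ (i + 1) * F i d = 0 := by
  have h := factorial_mul_sum_F d (fun k => (-1) ^ k)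
  simp only [sum_neg_one_pow_setChains] at h
  push_cast at h
  have hf : (1 : ℚ) < ((d + 1).factorial : ℚ) := by
    have : 1 < (d + 1).factorial := Nat.one_lt_factorial.2 (by omega)
    exact_mod_cast this
  have : (((d + 1).factorial : ℚ) - 1) *
      ∑ i ∈ Finset.range (d + 1), (-1 : ℚ) ^ (i + 1) * F i d = 0 := by rw [sub_mul, h]; ring
  rcases mul_eq_zero.1 this with h | h
  · linarith
  · exact h

/-! ### The coefficient `H 1 d`, that is, the derivative of `F_d` at `-1` -/

lemma H_one_eq (d : ℕ) (hd : 1 ≤ d) :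
    H 1 d = -(-1) ^ d * ∑ i ∈ Finset.range (d + 1), ((i + 1 : ℕ) * (-1 : ℚ) ^ (i + 1)) * F i d := by
  have h1 : H 1 d = ∑ i ∈ Finset.range (d + 1), F i d * (((d - i : ℕ) : ℚ) * (-1) ^ (d - i - 1)) := by
    rw [H, Polynomial.taylor_coeff_one, FPoly, Polynomial.derivative_sum, Polynomial.eval_finsetSum]
    refine Finset.sum_congr rfl fun i _ => ?_
    simp [Polynomial.derivative_X_pow]
  -- Write `d - i = (d + 1) - (i + 1)`; the `d + 1` part is a multiple of `F_d(-1) = 0`.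
  have h2 : ∀ i ∈ Finset.range (d + 1), F i d * (((d - i : ℕ) : ℚ) * (-1) ^ (d - i - 1)) =
      (-1) ^ d * (d + 1) * ((-1 : ℚ) ^ (i + 1) * F i d) +
        (-(-1) ^ d) * (((i + 1 : ℕ) * (-1 : ℚ) ^ (i + 1)) * F i d) := by
    intro i hi
    have hi' := Finset.mem_range.1 hi
    rcases (show i ≤ d by omega).eq_or_lt with rfl | hlt
    · simp
      ring
    · obtain ⟨e, rfl⟩ : ∃ e, d = i + 1 + e := ⟨d - i - 1, by omega⟩
      have e1 : i + 1 + e - i = e + 1 := by omega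
      have hsq : (-1 : ℚ) ^ (i + 1) * (-1) ^ (i + 1) = 1 := by
        rw [← mul_pow]; norm_num
      rw [e1, Nat.add_sub_cancel, pow_add (-1 : ℚ) (i + 1) e]
      push_cast
      linear_combination (-(e + 1) * F i (i + 1 + e) * (-1) ^ e) * hsq
  rw [h1, Finset.sum_congr rfl h2, Finset.sum_add_distrib, ← Finset.mul_sum, ← Finset.mul_sum,
    sum_neg_one_pow_mul_F hd, mul_zero, zero_add]

lemma abs_H_one_le {d : ℕ} (hd : 1 ≤ d) : |H 1 d| ≤ 2 * 3 ^ (d + 1) / (d + 1).factorial := by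
  rw [H_one_eq d hd, abs_mul, abs_neg, abs_pow, abs_neg, abs_one, one_pow, one_mul]
  have hf : (0 : ℚ) < ((d + 1).factorial : ℚ) := by exact_mod_cast Nat.factorial_pos _
  rw [le_div_iff₀ hf, ← abs_of_pos hf, ← abs_mul, mul_comm]
  have h := factorial_mul_sum_F d (fun k => k * (-1) ^ k)
  simp only [sum_mul_neg_one_pow_setChains] at h
  push_cast at h
  push_cast
  rw [h]
  calc |∑ j ∈ Finset.range (d + 1), ((-2 : ℚ) ^ (j + 1) - (-1) ^ (j + 1)) * F j d|
      ≤ ∑ j ∈ Finset.range (d + 1), 2 * (2 ^ (j + 1) * ((d + 1).choose (j + 1) : ℚ)) := by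
        refine (Finset.abs_sum_le_sum_abs _ _).trans (Finset.sum_le_sum fun j hj => ?_)
        have hj' := Finset.mem_range.1 hj
        rw [abs_mul, abs_of_nonneg (F_nonneg (by omega)), ← mul_assoc]
        refine mul_le_mul ?_ (F_le_choose (by omega)) (F_nonneg (by omega)) (by positivity)
        refine (abs_sub _ _).trans ?_
        rw [abs_pow, abs_pow]
        norm_num
        have : (1 : ℚ) ≤ 2 ^ (j + 1) := one_le_pow₀ (by norm_num)
        linarith
    _ ≤ 2 * 3 ^ (d + 1) := by
        rw [← Finset.mul_sum]
        refine mul_le_mul_of_nonneg_left ?_ (by norm_num)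
        have := add_pow (2 : ℚ) 1 (d + 1)
        rw [Finset.sum_range_succ'] at this
        norm_num at this
        rw [this]
        linarith

/-! ### Chains and dimension of `P_n` -/

lemma le_dim {P : Type*} [PartialOrder P] [Finite P] {i : ℕ} (h : Nonempty (StrictChain P i)) :
    i ≤ dim P := by
  refine le_csSup ⟨Nat.card P, ?_⟩ h
  rintro j ⟨c⟩
  have := Nat.card_le_card_of_injective c.1 c.2.injective
  rw [Nat.card_fin] at this
  omega

lemma numChains_eq_sum {P : Type*} [PartialOrder P] [Fintype P] (i : ℕ) :
    numChains P i = ∑ a : P, numChainsTo i a := by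
  unfold numChains numChainsTo
  rw [← Nat.card_congr (Equiv.sigmaFiberEquiv fun c : StrictChain P i => c.1 (Fin.last i)),
    Nat.card_sigma]

/-- The element of the poset with a given set of prime factors. -/
lemma exists_sqfree {n : ℕ} {t : Finset ℕ} (hp : ∀ p ∈ t, p.Prime) (ht : t.Nonempty)
    (hn : ∏ p ∈ t, p ≤ n) : ∃ b : SqfreePoset n, b.1.primeFactors = t := by
  have h1 : (∏ p ∈ t, p).primeFactors = t := Nat.primeFactors_prod hp
  have h0 : ∏ p ∈ t, p ≠ 0 := Finset.prod_ne_zero_iff.2 fun p h => (hp p h).ne_zero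
  refine ⟨⟨∏ p ∈ t, p, ?_, ?_, hn⟩, h1⟩
  · refine (Finset.squarefree_prod_of_pairwise_isCoprime ?_ ?_)
    · intro p hpt q hqt hpq
      exact Nat.coprime_iff_isRelPrime.1 ((Nat.coprime_primes (hp p hpt) (hp q hqt)).2 hpq)
    · exact fun p h => (hp p h).squarefree
  · obtain ⟨p, hpt⟩ := ht
    exact (hp p hpt).two_le.trans (Nat.le_of_dvd (Nat.pos_of_ne_zero h0) (Finset.dvd_prod_of_mem _ hpt))

/-- Taking prime factors identifies `P_n` with a family of nonempty sets of primes that is closed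
under nonempty subsets, divisors of `a` being at most `n`. -/
lemma numChainsTo_sqfree {n : ℕ} (i : ℕ) (a : SqfreePoset n) :
    numChainsTo i a = setChains (i + 1) a.1.primeFactors.card := by
  have hinj : Function.Injective (fun a : SqfreePoset n => a.1.primeFactors) := by
    intro a b h
    simp only at h
    apply Subtype.ext
    rw [← Nat.prod_primeFactors_of_squarefree a.2.1, h,
      Nat.prod_primeFactors_of_squarefree b.2.1]
  have hle : ∀ a b : SqfreePoset n, b ≤ a ↔ b.1.primeFactors ⊆ a.1.primeFactors := by
    intro a b
    have ha : a.1 ≠ 0 := by have := a.2.2.1; omega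
    refine ⟨fun h => Nat.primeFactors_mono h ha, fun h => ?_⟩
    have h1 := Finset.prod_dvd_prod_of_subset _ _ (fun p : ℕ => p) h
    rwa [Nat.prod_primeFactors_of_squarefree a.2.1,
      Nat.prod_primeFactors_of_squarefree b.2.1] at h1
  refine numChainsTo_eq_setChains (fun a : SqfreePoset n => a.1.primeFactors) ?_ hinj ?_ ?_ i a
  · intro a b
    rw [lt_iff_le_not_ge, hle, hle]
    rfl
  · intro a
    exact Nat.nonempty_primeFactors.2 (by have := a.2.2.1; omega)
  · intro a t ht hta
    refine exists_sqfree (fun p h => Nat.prime_of_mem_primeFactors (hta h)) ht (le_trans ?_ a.2.2.2)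
    have h1 := Finset.prod_dvd_prod_of_subset _ _ (fun p : ℕ => p) hta
    rw [Nat.prod_primeFactors_of_squarefree a.2.1] at h1
    exact Nat.le_of_dvd (by have := a.2.2.1; omega) h1

/-- An element with `m + 1` prime factors ends `(m + 1)! > 0` chains of length `m`. -/
lemma card_primeFactors_le {n : ℕ} (a : SqfreePoset n) :
    a.1.primeFactors.card ≤ dimP n + 1 := by
  have h2 : 0 < a.1.primeFactors.card :=
    (Nat.nonempty_primeFactors.2 (by have := a.2.2.1; omega)).card_pos
  obtain ⟨m, hm⟩ : ∃ m, a.1.primeFactors.card = m + 1 := ⟨a.1.primeFactors.card - 1, by omega⟩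
  have h := numChainsTo_sqfree m a
  rw [hm, setChains_self] at h
  have hpos : 0 < numChainsTo m a := h ▸ Nat.factorial_pos _
  obtain ⟨⟨c, -⟩⟩ := (Nat.card_pos_iff.1 hpos).1
  have := le_dim ⟨c⟩
  rw [hm]
  exact Nat.succ_le_succ this

lemma numChains_dimP_eq (n : ℕ) : numChains (SqfreePoset n) (dimP n) =
    (dimP n + 1).factorial * Nat.card {a : SqfreePoset n // a.1.primeFactors.card = dimP n + 1} := by
  classical
  let _ : Fintype (SqfreePoset n) := Fintype.ofFinite _
  rw [numChains_eq_sum, Nat.card_eq_fintype_card, Fintype.card_subtype, Finset.card_filter,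
    Finset.mul_sum]
  refine Finset.sum_congr rfl fun a _ => ?_
  rw [numChainsTo_sqfree]
  split_ifs with h
  · rw [h, setChains_self, mul_one]
  · rw [setChains_eq_zero, mul_zero]
    exact lt_of_le_of_ne (card_primeFactors_le a) h

/-- Otherwise this product would be an element of `P_n` with one prime factor too many. -/
lemma lt_prod_nth_prime (n : ℕ) : n < ∏ j ∈ Finset.range (dimP n + 2), Nat.nth Nat.Prime j := by
  by_contra! h
  have hinj : Function.Injective (Nat.nth Nat.Prime) :=
    Nat.nth_injective Nat.infinite_setOfPred_prime
  obtain ⟨b, hb⟩ := exists_sqfree (n := n)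
    (t := (Finset.range (dimP n + 2)).image (Nat.nth Nat.Prime))
    (by
      intro p hp
      obtain ⟨j, -, rfl⟩ := Finset.mem_image.1 hp
      exact Nat.prime_nth_prime j) (by simp)
    (by rwa [Finset.prod_image fun x _ y _ h => hinj h])
  have := card_primeFactors_le b
  rw [hb, Finset.card_image_of_injective _ hinj, Finset.card_range] at this
  omega

/-! ### Rankin's method and Chebyshev estimates -/

/-- Rankin's bound for the number of squarefree integers up to `n` with `D` prime factors. -/
lemma card_sqfree_le (n D : ℕ) {z : ℝ} (hz : 0 < z) :
    (Nat.card {a : SqfreePoset n // a.1.primeFactors.card = D} : ℝ) ≤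
      n ^ 2 / z ^ D * ∏ p ∈ Nat.primesLE n, (1 + z / (p : ℝ) ^ 2) := by
  classical
  let _ : Fintype (SqfreePoset n) := Fintype.ofFinite _
  rw [Nat.card_eq_fintype_card, Fintype.card_subtype, Finset.prod_one_add, Finset.card_eq_sum_ones,
    Finset.mul_sum]
  push_cast
  have hinj : Set.InjOn (fun a : SqfreePoset n => a.1.primeFactors)
      (Finset.univ.filter fun a : SqfreePoset n => a.1.primeFactors.card = D) := by
    intro a _ b _ h
    simp only at h
    apply Subtype.ext
    rw [← Nat.prod_primeFactors_of_squarefree a.2.1, h,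
      Nat.prod_primeFactors_of_squarefree b.2.1]
  -- Each `a` gets the weight `(n / a)^2 ≥ 1`, written multiplicatively over its primes; the factors
  -- `z` cancel because there are exactly `D` of them.
  calc ∑ a : SqfreePoset n with a.1.primeFactors.card = D, (1 : ℝ)
      ≤ ∑ a : SqfreePoset n with a.1.primeFactors.card = D,
          (n : ℝ) ^ 2 / z ^ D * ∏ p ∈ a.1.primeFactors, (z / (p : ℝ) ^ 2) := by
        refine Finset.sum_le_sum fun a ha => ?_
        have ha' := (Finset.mem_filter.1 ha).2
        rw [Finset.prod_div_distrib, Finset.prod_const, ha', Finset.prod_pow, ← Nat.cast_prod,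
          Nat.prod_primeFactors_of_squarefree a.2.1]
        have h2 : (0 : ℝ) < a.1 := by have := a.2.2.1; exact_mod_cast (by omega : 0 < a.1)
        have h3 : (a.1 : ℝ) ≤ n := by exact_mod_cast a.2.2.2
        rw [div_mul_div_comm, one_le_div (by positivity), mul_comm]
        gcongr
    _ = ∑ t ∈ (Finset.univ.filter fun a : SqfreePoset n => a.1.primeFactors.card = D).image
          (fun a : SqfreePoset n => a.1.primeFactors), (n : ℝ) ^ 2 / z ^ D * ∏ p ∈ t, (z / (p : ℝ) ^ 2) := by
        rw [Finset.sum_image hinj]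
    _ ≤ ∑ t ∈ (Nat.primesLE n).powerset, n ^ 2 / z ^ D * ∏ p ∈ t, (z / (p : ℝ) ^ 2) := by
        refine Finset.sum_le_sum_of_subset_of_nonneg ?_ fun t _ _ => by positivity
        intro t ht
        obtain ⟨a, -, rfl⟩ := Finset.mem_image.1 ht
        refine Finset.mem_powerset.2 fun p hp => Nat.mem_primesLE.2 ⟨?_, Nat.prime_of_mem_primeFactors hp⟩
        exact (Nat.le_of_mem_primeFactors hp).trans a.2.2.2

lemma primeCounting_nth_prime (j : ℕ) : Nat.primeCounting (Nat.nth Nat.Prime j) = j + 1 := by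
  rw [Nat.primeCounting, Nat.primeCounting', Nat.count_nth_succ_of_infinite Nat.infinite_setOfPred_prime]

lemma two_le_nth_prime (j : ℕ) : (2 : ℝ) ≤ Nat.nth Nat.Prime j := by
  exact_mod_cast (Nat.prime_nth_prime j).two_le

lemma succ_mul_log_nth_prime_le (j : ℕ) :
    ((j : ℝ) + 1) * Real.log (Nat.nth Nat.Prime j) ≤ 5 * Nat.nth Nat.Prime j := by
  set q : ℝ := ((Nat.nth Nat.Prime j : ℕ) : ℝ) with hq
  have hq2 : 2 ≤ q := two_le_nth_prime j
  have h := Chebyshev.pi_le_log4_mul_div (x := q) (by linarith)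
  rw [hq, Nat.floor_natCast, primeCounting_nth_prime, ← hq] at h
  push_cast at h
  have hs : 1 < √q := Real.lt_sqrt_of_sq_lt (by linarith)
  have hl : 0 < Real.log √q := Real.log_pos hs
  have hlog : Real.log √q ≤ √q - 1 := Real.log_le_sub_one_of_pos (by linarith)
  have h2 : Real.log q = 2 * Real.log √q := by
    rw [Real.log_sqrt (by linarith)]; ring
  have h4 : Real.log 4 ≤ 1.4 := by
    rw [show (4 : ℝ) = 2 ^ 2 by norm_num, Real.log_pow]
    have := Real.log_two_lt_d9
    push_cast
    linarith
  have hsq : √q * √q = q := Real.mul_self_sqrt (by linarith)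
  -- With the bounds below this gives `(j + 1) log q ≤ 2 (1.4 + 1) q = 4.8 q`, whence the constant
  -- `5`.
  have h5 : ((j : ℝ) + 1) * Real.log √q ≤ Real.log 4 * q + √q * Real.log √q := by
    refine (mul_le_mul_of_nonneg_right h hl.le).trans_eq ?_
    field_simp
  have h6 : √q * Real.log √q ≤ q := by
    calc √q * Real.log √q ≤ √q * √q := by gcongr; linarith
      _ = q := hsq
  have h7 : Real.log 4 * q ≤ 1.4 * q := by gcongr
  rw [h2]
  linarith

lemma nth_prime_ge (j : ℕ) :
    ((j : ℝ) + 1) * max 1 (Real.log (j + 1)) ≤ 5 * Nat.nth Nat.Prime j := by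
  have hj : ((j : ℝ) + 1) ≤ Nat.nth Nat.Prime j := by
    have := Nat.add_two_le_nth_prime j
    exact_mod_cast (by omega : j + 1 ≤ Nat.nth Nat.Prime j)
  have hj0 : (0 : ℝ) ≤ j := Nat.cast_nonneg j
  rcases max_cases (1 : ℝ) (Real.log (j + 1)) with ⟨h, -⟩ | ⟨h, -⟩ <;> rw [h]
  · linarith
  · refine le_trans ?_ (succ_mul_log_nth_prime_le j)
    gcongr

lemma log_nth_prime_le_and (j : ℕ) : Real.log (Nat.nth Nat.Prime j) ≤ 4 * Real.log (j + 3) ∧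
    (Nat.nth Nat.Prime j : ℝ) ≤ 6 * ((j + 3) * Real.log (j + 3)) := by
  have h := Chebyshev.pi_ge (Nat.nth Nat.Prime j)
  rw [primeCounting_nth_prime] at h
  set q : ℝ := ((Nat.nth Nat.Prime j : ℕ) : ℝ) with hq
  have hq2 : 2 ≤ q := two_le_nth_prime j
  have hj0 : (0 : ℝ) ≤ j := Nat.cast_nonneg j
  have hlq : 0 < Real.log q := Real.log_pos (by linarith)
  rw [div_le_iff₀ hlq] at h
  push_cast at h
  have h1 : Real.log (q + 1) ≤ 2 * Real.log q := by
    rw [show 2 * Real.log q = Real.log (q ^ 2) by rw [Real.log_pow]; norm_num]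
    exact Real.log_le_log (by linarith) (by nlinarith)
  have hlog2 := Real.log_two_gt_d9
  -- Bootstrap: the crude `log q ≤ 2√q` inserted here makes `q` polynomial in `j`, so `log q ≤ 4 log
  -- (j + 3)`; inserting that gives the second bound, as `4 / log 2 < 6`.
  have h2 : q * Real.log 2 ≤ (j + 3) * Real.log q := by linarith
  have hs1 : 1 < √q := Real.lt_sqrt_of_sq_lt (by linarith)
  have hsq : √q * √q = q := Real.mul_self_sqrt (by linarith)
  have h3 : Real.log q ≤ 2 * √q := by
    have := Real.log_le_sub_one_of_pos (show 0 < √q by linarith)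
    rw [Real.log_sqrt (by linarith)] at this
    linarith
  have h4 : √q ≤ 3 * (j + 3) := by
    have h5 : √q * (√q * Real.log 2) ≤ √q * ((j + 3) * 2) := by
      calc √q * (√q * Real.log 2) = q * Real.log 2 := by rw [← mul_assoc, hsq]
        _ ≤ (j + 3) * Real.log q := h2
        _ ≤ (j + 3) * (2 * √q) := by gcongr
        _ = _ := by ring
    have h6 := le_of_mul_le_mul_left h5 (by linarith)
    nlinarith
  have h5 : q ≤ ((j : ℝ) + 3) ^ 4 := by
    calc q = √q * √q := hsq.symm
      _ ≤ (3 * (j + 3)) * (3 * (j + 3)) := by gcongr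
      _ = 3 ^ 2 * ((j : ℝ) + 3) ^ 2 := by ring
      _ ≤ ((j : ℝ) + 3) ^ 2 * ((j : ℝ) + 3) ^ 2 := by gcongr; linarith
      _ = _ := by ring
  have h6 : Real.log q ≤ 4 * Real.log (j + 3) := by
    calc Real.log q ≤ Real.log (((j : ℝ) + 3) ^ 4) := Real.log_le_log (by linarith) h5
      _ = _ := by rw [Real.log_pow]; norm_num
  refine ⟨h6, ?_⟩
  have h7 : q * Real.log 2 ≤ (j + 3) * (4 * Real.log (j + 3)) := h2.trans (by gcongr)
  nlinarith

lemma primesLE_eq_image (n : ℕ) :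
    Nat.primesLE n = (Finset.range (Nat.primeCounting n)).image (Nat.nth Nat.Prime) := by
  ext p
  rw [Nat.mem_primesLE, Finset.mem_image]
  constructor
  · rintro ⟨hpn, hp⟩
    refine ⟨Nat.count Nat.Prime p, ?_, Nat.nth_count hp⟩
    rw [Finset.mem_range]
    exact Nat.count_strict_mono hp (by omega)
  · rintro ⟨j, hj, rfl⟩
    rw [Finset.mem_range] at hj
    exact ⟨Nat.lt_succ_iff.1 (Nat.nth_lt_of_lt_count hj), Nat.prime_nth_prime j⟩

lemma sum_inv_sq_le {D : ℕ} (hD : 0 < D) (M : ℕ) :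
    ∑ i ∈ Finset.range M, 1 / ((D : ℝ) + i + 1) ^ 2 ≤ 1 / (D : ℝ) - 1 / ((D : ℝ) + M) := by
  have hD' : (0 : ℝ) < D := by exact_mod_cast hD
  induction M with
  | zero => simp
  | succ M ih =>
    rw [Finset.sum_range_succ]
    have h1 : 1 / ((D : ℝ) + M + 1) ^ 2 ≤ 1 / (D + M) - 1 / (D + M + 1) := by
      have h0 : (0 : ℝ) < D + M := by positivity
      rw [div_sub_div _ _ h0.ne' (by positivity), div_le_div_iff₀ (by positivity) (by positivity)]
      nlinarith
    push_cast
    rw [← add_assoc]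
    linarith

/-- Enlarging the product to the first `D + π(n)` primes avoids comparing `D` with `π(n)`; all
factors are at least `1`. -/
lemma prod_primesLE_le (D n : ℕ) {z : ℝ} (hz : 0 < z) :
    ∏ p ∈ Nat.primesLE n, (1 + z / (p : ℝ) ^ 2) ≤
      (∏ j ∈ Finset.range D, (1 + z / (Nat.nth Nat.Prime j : ℝ) ^ 2)) *
      ∏ i ∈ Finset.range (Nat.primeCounting n), (1 + z / (Nat.nth Nat.Prime (D + i) : ℝ) ^ 2) := by
  rw [primesLE_eq_image,
    Finset.prod_image fun x _ y _ h => Nat.nth_injective Nat.infinite_setOfPred_prime h,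
    ← Finset.prod_range_add (fun j => 1 + z / (Nat.nth Nat.Prime j : ℝ) ^ 2), add_comm D,
    Finset.prod_range_add]
  have h1 : ∀ j : ℕ, 1 ≤ 1 + z / (Nat.nth Nat.Prime j : ℝ) ^ 2 := fun j => by
    have : 0 ≤ z / (Nat.nth Nat.Prime j : ℝ) ^ 2 := by positivity
    linarith
  refine le_mul_of_one_le_right (Finset.prod_nonneg fun j _ => by linarith [h1 j]) ?_
  calc (1 : ℝ) = ∏ _j ∈ Finset.range D, (1 : ℝ) := Finset.prod_const_one.symm
    _ ≤ _ := Finset.prod_le_prod (fun _ _ => zero_le_one) fun j _ => h1 (Nat.primeCounting n + j)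

/-- Beyond index `D` the `j`-th prime is at least `(j + 1) log D / 5`, so the logarithm of the
product is at most `25 D^2 ∑ 1 / (j + 1)^2 ≤ 25 D`. -/
lemma prod_tail_le {D : ℕ} (hD : 2 ≤ D) (M : ℕ) :
    ∏ i ∈ Finset.range M,
      (1 + ((D : ℝ) * Real.log D) ^ 2 / (Nat.nth Nat.Prime (D + i) : ℝ) ^ 2) ≤
      Real.exp 25 ^ D := by
  have hD' : (2 : ℝ) ≤ D := by exact_mod_cast hD
  have hl : 0 < Real.log D := Real.log_pos (by linarith)
  calc _ ≤ ∏ i ∈ Finset.range M, Real.exp (25 * D ^ 2 * (1 / ((D : ℝ) + i + 1) ^ 2)) := by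
        refine Finset.prod_le_prod (fun i _ => by positivity) fun i _ => ?_
        refine le_trans ?_ (Real.add_one_le_exp _)
        rw [add_comm]
        gcongr
        have hq := nth_prime_ge (D + i)
        push_cast at hq
        have h2 : ((D : ℝ) + i + 1) * Real.log D ≤ 5 * Nat.nth Nat.Prime (D + i) := by
          refine le_trans ?_ hq
          gcongr
          refine le_trans ?_ (le_max_right _ _)
          refine Real.log_le_log (by linarith) ?_
          have : (0 : ℝ) ≤ i := Nat.cast_nonneg i
          linarith
        have hq0 := two_le_nth_prime (D + i)
        rw [mul_one_div, div_le_div_iff₀ (by positivity) (by positivity)]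
        calc ((D : ℝ) * Real.log D) ^ 2 * ((D : ℝ) + i + 1) ^ 2
            = (D : ℝ) ^ 2 * (((D : ℝ) + i + 1) * Real.log D) ^ 2 := by ring
          _ ≤ (D : ℝ) ^ 2 * (5 * (Nat.nth Nat.Prime (D + i) : ℝ)) ^ 2 := by gcongr
          _ = _ := by ring
    _ = Real.exp (25 * D ^ 2 * ∑ i ∈ Finset.range M, 1 / ((D : ℝ) + i + 1) ^ 2) := by
        rw [← Real.exp_sum, Finset.mul_sum]
    _ ≤ Real.exp (D * 25) := by
        refine Real.exp_le_exp.2 ?_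
        have h := sum_inv_sq_le (D := D) (by omega) M
        have h2 : (0 : ℝ) ≤ 1 / (D + M) := by positivity
        calc 25 * (D : ℝ) ^ 2 * ∑ i ∈ Finset.range M, 1 / ((D : ℝ) + i + 1) ^ 2
            ≤ 25 * (D : ℝ) ^ 2 * (1 / (D : ℝ)) := by gcongr; linarith
          _ = (D : ℝ) * 25 := by field_simp
    _ = Real.exp 25 ^ D := by rw [Real.exp_nat_mul]

/-- Here the primes are at most `24 D log D`, so the summand `1` is at most `576 = 24^2` times the
other one. -/
lemma prod_head_le {D : ℕ} (hD : 2 ≤ D) :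
    ∏ j ∈ Finset.range D, (1 + ((D : ℝ) * Real.log D) ^ 2 / (Nat.nth Nat.Prime j : ℝ) ^ 2) ≤
      577 ^ D * ((D : ℝ) * Real.log D) ^ (2 * D) /
        (∏ j ∈ Finset.range D, (Nat.nth Nat.Prime j : ℝ)) ^ 2 := by
  have hD' : (2 : ℝ) ≤ D := by exact_mod_cast hD
  have hl : 0 < Real.log D := Real.log_pos (by linarith)
  rw [← Finset.prod_pow, pow_mul, ← mul_pow]
  have hc : (577 * ((D : ℝ) * Real.log D) ^ 2) ^ D =
      ∏ _j ∈ Finset.range D, (577 * ((D : ℝ) * Real.log D) ^ 2) := by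
    rw [Finset.prod_const, Finset.card_range]
  rw [hc, ← Finset.prod_div_distrib]
  refine Finset.prod_le_prod (fun i _ => by positivity) fun j hj => ?_
  have hj' : (j : ℝ) + 1 ≤ D := by exact_mod_cast Finset.mem_range.1 hj
  have hj0 : (0 : ℝ) ≤ j := Nat.cast_nonneg j
  have hq0 := two_le_nth_prime j
  have h1 : (Nat.nth Nat.Prime j : ℝ) ≤ 24 * (D * Real.log D) := by
    have hlog : Real.log (j + 3) ≤ 2 * Real.log D := by
      rw [show 2 * Real.log D = Real.log ((D : ℝ) ^ 2) by rw [Real.log_pow]; norm_num]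
      exact Real.log_le_log (by linarith) (by nlinarith)
    calc (Nat.nth Nat.Prime j : ℝ) ≤ 6 * ((j + 3) * Real.log (j + 3)) := (log_nth_prime_le_and j).2
      _ ≤ 6 * ((2 * D) * (2 * Real.log D)) := by
        have : 0 ≤ Real.log (j + 3) := Real.log_nonneg (by linarith)
        gcongr
        linarith
      _ = _ := by ring
  have h2 : (Nat.nth Nat.Prime j : ℝ) ^ 2 ≤ (24 * (D * Real.log D)) ^ 2 := by gcongr
  rw [le_div_iff₀ (by positivity), add_mul, div_mul_cancel₀ _ (by positivity)]
  linarith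

lemma factorial_mul_rankin_le {D : ℕ} (hD : 2 ≤ D) {n : ℕ}
    (hn : n < ∏ j ∈ Finset.range (D + 1), Nat.nth Nat.Prime j) :
    (D.factorial : ℝ) * (n ^ 2 / (((D : ℝ) * Real.log D) ^ 2) ^ D *
      ∏ p ∈ Nat.primesLE n, (1 + ((D : ℝ) * Real.log D) ^ 2 / (p : ℝ) ^ 2)) ≤
      n * Nat.nth Nat.Prime D * (2885 * Real.exp 25) ^ D /
        ∏ j ∈ Finset.range D, max 1 (Real.log ((j : ℝ) + 1)) := by
  have hD' : (2 : ℝ) ≤ D := by exact_mod_cast hD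
  have hl : 0 < Real.log D := Real.log_pos (by linarith)
  have hy : 0 < (D : ℝ) * Real.log D := by positivity
  set y := (D : ℝ) * Real.log D with hydef
  set Q : ℝ := ∏ j ∈ Finset.range D, (Nat.nth Nat.Prime j : ℝ) with hQ
  set L : ℝ := ∏ j ∈ Finset.range D, max 1 (Real.log ((j : ℝ) + 1)) with hL
  have hQ0 : 0 < Q := Finset.prod_pos fun j _ => by have := two_le_nth_prime j; linarith
  have hL0 : 0 < L := Finset.prod_pos fun j _ => by positivity
  have hprod : ∏ p ∈ Nat.primesLE n, (1 + y ^ 2 / (p : ℝ) ^ 2) ≤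
      577 ^ D * y ^ (2 * D) / Q ^ 2 * Real.exp 25 ^ D := by
    refine (prod_primesLE_le D n (by positivity)).trans ?_
    exact mul_le_mul (prod_head_le hD) (prod_tail_le hD _)
      (Finset.prod_nonneg fun i _ => by positivity) (by positivity)
  have hfac : (D.factorial : ℝ) * L ≤ 5 ^ D * Q := by
    have h1 : (D.factorial : ℝ) = ∏ j ∈ Finset.range D, ((j : ℝ) + 1) := by
      rw [← Finset.prod_range_add_one_eq_factorial]; push_cast; rfl
    have h2 : (5 : ℝ) ^ D = ∏ _j ∈ Finset.range D, (5 : ℝ) := by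
      rw [Finset.prod_const, Finset.card_range]
    rw [h1, h2, hL, hQ, ← Finset.prod_mul_distrib, ← Finset.prod_mul_distrib]
    exact Finset.prod_le_prod (fun j _ => by positivity) fun j _ => nth_prime_ge j
  have hnQ : (n : ℝ) ≤ Q * Nat.nth Nat.Prime D := by
    rw [Finset.prod_range_succ] at hn
    have : (n : ℝ) < ((∏ j ∈ Finset.range D, Nat.nth Nat.Prime j) * Nat.nth Nat.Prime D : ℕ) := by
      exact_mod_cast hn
    rw [Nat.cast_mul, Nat.cast_prod] at this
    exact this.le
  rw [le_div_iff₀ hL0]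
  -- The powers of `y` cancel; one factor `n` is traded for `Q` times the next prime, and `D!` for
  -- `5^D Q / L`, so that `Q^2` cancels too.
  calc (D.factorial : ℝ) * (n ^ 2 / (y ^ 2) ^ D * ∏ p ∈ Nat.primesLE n, (1 + y ^ 2 / (p : ℝ) ^ 2)) * L
      ≤ (D.factorial : ℝ) *
        (n ^ 2 / (y ^ 2) ^ D * (577 ^ D * y ^ (2 * D) / Q ^ 2 * Real.exp 25 ^ D)) * L := by gcongr
    _ = ((D.factorial : ℝ) * L) * (n * n / Q ^ 2 * (577 ^ D * Real.exp 25 ^ D)) := by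
        rw [pow_mul y 2 D]; field_simp
    _ ≤ (5 ^ D * Q) * (n * (Q * Nat.nth Nat.Prime D) / Q ^ 2 * (577 ^ D * Real.exp 25 ^ D)) := by
        gcongr
    _ = n * Nat.nth Nat.Prime D * (2885 * Real.exp 25) ^ D := by
        rw [show (2885 : ℝ) = 5 * 577 by norm_num, mul_pow, mul_pow]
        field_simp

/-! ### Asymptotics in `D` and the passage to `n` -/

/-- The factors with `j ≥ D / 2` already suffice: each is at least `log (D / 2) ≥ (log D) / 2`. -/
lemma log_prod_max_ge {D : ℕ} (hD : 8 ≤ D) :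
    (D : ℝ) / 2 * (Real.log (Real.log D) - Real.log 2) ≤
      Real.log (∏ j ∈ Finset.range D, max 1 (Real.log ((j : ℝ) + 1))) := by
  have hD' : (8 : ℝ) ≤ D := by exact_mod_cast hD
  have hlog2 := Real.log_two_gt_d9
  have hl : 2 ≤ Real.log D := by
    calc (2 : ℝ) ≤ 3 * Real.log 2 := by linarith
      _ = Real.log 8 := by rw [show (8 : ℝ) = 2 ^ 3 by norm_num, Real.log_pow]; norm_num
      _ ≤ Real.log D := Real.log_le_log (by norm_num) hD'
  have hll : 0 ≤ Real.log (Real.log D) - Real.log 2 := by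
    have := Real.log_le_log (by norm_num) hl
    linarith
  rw [Real.log_prod fun j _ => by positivity]
  have h1 : ∀ j ∈ Finset.Ico (D / 2) D, Real.log (Real.log D) - Real.log 2 ≤
      Real.log (max 1 (Real.log ((j : ℝ) + 1))) := by
    intro j hj
    have hj' := Finset.mem_Ico.1 hj
    have h2 : (D : ℝ) / 2 ≤ (j : ℝ) + 1 := by
      have : (D : ℝ) ≤ 2 * ((j : ℝ) + 1) := by exact_mod_cast (by omega : D ≤ 2 * (j + 1))
      linarith
    rw [← Real.log_div (by linarith) (by norm_num)]
    refine Real.log_le_log (by linarith) (le_trans ?_ (le_max_right _ _))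
    calc Real.log D / 2 ≤ Real.log D - Real.log 2 := by
          have := Real.log_two_lt_d9
          linarith
      _ = Real.log (D / 2) := (Real.log_div (by linarith) (by norm_num)).symm
      _ ≤ _ := Real.log_le_log (by linarith) h2
  calc (D : ℝ) / 2 * (Real.log (Real.log D) - Real.log 2)
      ≤ ((D - D / 2 : ℕ) : ℝ) * (Real.log (Real.log D) - Real.log 2) := by
        refine mul_le_mul_of_nonneg_right ?_ hll
        have : (D : ℝ) ≤ 2 * ((D - D / 2 : ℕ) : ℝ) := by
          exact_mod_cast (by omega : D ≤ 2 * (D - D / 2))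
        linarith
    _ ≤ ∑ j ∈ Finset.Ico (D / 2) D, Real.log (max 1 (Real.log ((j : ℝ) + 1))) := by
        have := Finset.card_nsmul_le_sum _ _ _ h1
        rwa [Nat.card_Ico, nsmul_eq_mul] at this
    _ ≤ ∑ j ∈ Finset.range D, Real.log (max 1 (Real.log ((j : ℝ) + 1))) := by
        refine Finset.sum_le_sum_of_subset_of_nonneg ?_ fun j _ _ =>
          Real.log_nonneg (le_max_left _ _)
        intro j hj
        exact Finset.mem_range.2 (Finset.mem_Ico.1 hj).2

/-- The quotient in Rankin's bound decays superexponentially. -/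
lemma eventually_nth_prime_mul_pow_div_le {B : ℝ} (hB : 0 < B) : ∀ᶠ D : ℕ in atTop,
    Nat.nth Nat.Prime D * B ^ D / ∏ j ∈ Finset.range D, max 1 (Real.log ((j : ℝ) + 1)) ≤
      Real.exp (-((D : ℝ) * Real.log (Real.log D) / 4)) := by
  have hll : Tendsto (fun D : ℕ => Real.log (Real.log (D : ℝ))) atTop atTop :=
    Real.tendsto_log_atTop.comp (Real.tendsto_log_atTop.comp tendsto_natCast_atTop_atTop)
  -- The threshold ensures that half of the saving `(D / 2) log log D` absorbs `B^D`, the `log 2`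
  -- loss and the bound `exp (6 D)` for the prime.
  filter_upwards [eventually_ge_atTop 8,
    hll.eventually_ge_atTop (4 * (6 + Real.log B + Real.log 2 / 2))] with D hD hL
  have hD' : (8 : ℝ) ≤ D := by exact_mod_cast hD
  set L : ℝ := ∏ j ∈ Finset.range D, max 1 (Real.log ((j : ℝ) + 1)) with hLdef
  have hL0 : 0 < L := Finset.prod_pos fun j _ => by positivity
  have hq : (Nat.nth Nat.Prime D : ℝ) ≤ Real.exp (6 * D) := by
    have h1 : Real.log ((D : ℝ) + 3) ≤ (D : ℝ) + 3 := by
      have := Real.log_le_sub_one_of_pos (show (0 : ℝ) < D + 3 by linarith)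
      linarith
    have h2 : (D : ℝ) + 3 ≤ Real.exp (2 * D) := by
      have := Real.add_one_le_exp (2 * (D : ℝ))
      linarith
    have h3 : (6 : ℝ) ≤ Real.exp (2 * D) := by linarith
    calc (Nat.nth Nat.Prime D : ℝ) ≤ 6 * ((D + 3) * Real.log (D + 3)) :=
          (log_nth_prime_le_and D).2
      _ ≤ 6 * ((D + 3) * (D + 3)) := by gcongr
      _ ≤ Real.exp (2 * D) * (Real.exp (2 * D) * Real.exp (2 * D)) := by gcongr
      _ = Real.exp (6 * D) := by rw [← Real.exp_add, ← Real.exp_add]; ring_nf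
  have hBD : B ^ D = Real.exp (D * Real.log B) := by
    rw [Real.exp_nat_mul, Real.exp_log hB]
  have hge := log_prod_max_ge hD
  have hmul := mul_le_mul_of_nonneg_left hL (show (0 : ℝ) ≤ D by linarith)
  calc Nat.nth Nat.Prime D * B ^ D / L
      ≤ Real.exp (6 * D) * Real.exp (D * Real.log B) / Real.exp (Real.log L) := by
        rw [Real.exp_log hL0, hBD]; gcongr
    _ = Real.exp (6 * D + D * Real.log B - Real.log L) := by
        rw [Real.exp_sub, Real.exp_add]
    _ ≤ _ := by
        refine Real.exp_le_exp.2 ?_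
        linarith

lemma tendsto_dimP : Tendsto dimP atTop atTop := by
  refine tendsto_atTop.2 fun b => ?_
  filter_upwards [eventually_ge_atTop (∏ j ∈ Finset.range (b + 2), Nat.nth Nat.Prime j)] with n hn
  by_contra! h
  have h1 := lt_prod_nth_prime n
  have h2 : ∏ j ∈ Finset.range (dimP n + 2), Nat.nth Nat.Prime j ≤
      ∏ j ∈ Finset.range (b + 2), Nat.nth Nat.Prime j :=
    Finset.prod_le_prod_of_subset_of_one_le' (Finset.range_mono (by omega))
      fun j _ _ => (Nat.prime_nth_prime j).one_le
  omega

lemma log_le_dimP {n : ℕ} (hn : 1 ≤ n) (hd : 3 ≤ dimP n + 1) :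
    Real.log n ≤ 16 * ((dimP n + 1 : ℕ) * Real.log (dimP n + 1 : ℕ)) := by
  have h := lt_prod_nth_prime n
  set D := dimP n + 1 with hD
  have hD' : (3 : ℝ) ≤ D := by exact_mod_cast hd
  have hn' : (0 : ℝ) < n := by exact_mod_cast hn
  have h1 : (n : ℝ) ≤ (Nat.nth Nat.Prime D : ℝ) ^ (D + 1) := by
    have h2 : ∏ j ∈ Finset.range (D + 1), Nat.nth Nat.Prime j ≤ Nat.nth Nat.Prime D ^ (D + 1) := by
      have := Finset.prod_le_pow_card (Finset.range (D + 1)) (Nat.nth Nat.Prime)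
        (Nat.nth Nat.Prime D) fun j hj =>
          Nat.nth_monotone Nat.infinite_setOfPred_prime (by have := Finset.mem_range.1 hj; omega)
      rwa [Finset.card_range] at this
    exact_mod_cast h.le.trans h2
  have hl3 : Real.log ((D : ℝ) + 3) ≤ 2 * Real.log D := by
    rw [show 2 * Real.log D = Real.log ((D : ℝ) ^ 2) by rw [Real.log_pow]; norm_num]
    exact Real.log_le_log (by linarith) (by nlinarith)
  have hl : 0 ≤ Real.log D := Real.log_nonneg (by linarith)
  calc Real.log n ≤ Real.log ((Nat.nth Nat.Prime D : ℝ) ^ (D + 1)) := Real.log_le_log hn' h1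
    _ = ((D : ℝ) + 1) * Real.log (Nat.nth Nat.Prime D) := by rw [Real.log_pow]; push_cast; rfl
    _ ≤ (2 * D) * (4 * (2 * Real.log D)) := by
        refine mul_le_mul (by linarith) ((log_nth_prime_le_and D).1.trans (by linarith))
          (Real.log_nonneg (by linarith [two_le_nth_prime D])) (by positivity)
    _ = _ := by ring

/-- Inverting `x ≤ 16 y log y` gives `y ≥ x / (16 log x) ≥ √x`, hence `log y ≥ (log x) / 2 ≥ √(log
x)` and `log log y ≥ (log log x) / 2`; the constant is `32 = 16 · 2`. -/
lemma eventually_le_mul_log_log : ∀ᶠ x : ℝ in atTop, ∀ y : ℝ, 3 ≤ y →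
    x ≤ 16 * (y * Real.log y) →
    x * Real.log (Real.log x) / Real.log x ≤ 32 * (y * Real.log (Real.log y)) := by
  have h1 : ∀ᶠ x : ℝ in atTop, Real.log x ≤ 1 / 16 * √x := by
    have h := (isLittleO_log_rpow_atTop (show (0 : ℝ) < 1 / 2 by norm_num)).bound
      (show (0 : ℝ) < 1 / 16 by norm_num)
    filter_upwards [h, eventually_ge_atTop 1] with x hx hx1
    rw [Real.norm_of_nonneg (Real.log_nonneg hx1), Real.norm_of_nonneg (by positivity),
      ← Real.sqrt_eq_rpow] at hx
    exact hx
  have h2 : ∀ᶠ x : ℝ in atTop, 4 ≤ Real.log x := Real.tendsto_log_atTop.eventually_ge_atTop 4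
  filter_upwards [h1, h2, eventually_ge_atTop 1] with x hx hlx hx1 y hy hxy
  have hsq : √x * √x = x := Real.mul_self_sqrt (by linarith)
  have hs : 1 ≤ √x := Real.one_le_sqrt.2 hx1
  have hxy' : x / (16 * Real.log x) ≤ y := by
    rw [div_le_iff₀ (by linarith)]
    by_contra! hlt
    have hyx : y < x := by nlinarith
    have : Real.log y ≤ Real.log x := Real.log_le_log (by linarith) hyx.le
    have : y * Real.log y ≤ y * Real.log x := by gcongr
    linarith
  have hsy : √x ≤ y := by
    refine le_trans ?_ hxy'
    rw [le_div_iff₀ (by linarith)]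
    nlinarith
  have hly : Real.log x / 2 ≤ Real.log y := by
    rw [← Real.log_sqrt (by linarith)]
    exact Real.log_le_log (by linarith) hsy
  have hlly : Real.log (Real.log x) / 2 ≤ Real.log (Real.log y) := by
    rw [← Real.log_sqrt (by linarith)]
    refine Real.log_le_log (by positivity) (le_trans ?_ hly)
    refine Real.sqrt_le_iff.2 ⟨by linarith, by nlinarith⟩
  have hll0 : 0 ≤ Real.log (Real.log x) := Real.log_nonneg (by linarith)
  calc x * Real.log (Real.log x) / Real.log x
      = 32 * (x / (16 * Real.log x) * (Real.log (Real.log x) / 2)) := by field_simp; ring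
    _ ≤ 32 * (y * Real.log (Real.log y)) := by gcongr

/-- The bound for the Euler characteristic in terms of the dimension. -/
lemma abs_chi_le {c : ℝ} (hc : 0 < c) {n : ℕ} (hd : 1 ≤ dimP n) (hχ : chi n ≠ 0)
    (h : c * (1 / ((dimP n + 1).factorial : ℝ)) ≤ |(alpha n : ℝ)|) :
    |(chi n : ℝ)| ≤ 2 / c * (n * (Nat.nth Nat.Prime (dimP n + 1) *
      (8655 * Real.exp 25) ^ (dimP n + 1) /
        ∏ j ∈ Finset.range (dimP n + 1), max 1 (Real.log ((j : ℝ) + 1)))) := by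
  have hn := lt_prod_nth_prime n
  have hN := numChains_dimP_eq n
  have hH := abs_H_one_le hd
  have hK : ∀ z : ℝ, 0 < z → _ := fun z hz => card_sqfree_le n (dimP n + 1) hz
  have hR := factorial_mul_rankin_le (D := dimP n + 1) (by omega) hn
  set D := dimP n + 1 with hD
  set K := Nat.card {a : SqfreePoset n // a.1.primeFactors.card = D}
  have hD' : (2 : ℝ) ≤ D := by exact_mod_cast (by omega : 2 ≤ D)
  have hl : 0 < Real.log D := Real.log_pos (by linarith)
  have hy : 0 < (D : ℝ) * Real.log D := by positivity
  have hf : (0 : ℝ) < (D.factorial : ℝ) := by exact_mod_cast Nat.factorial_pos _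
  have hχ' : 0 < |(chi n : ℝ)| := abs_pos.2 (by exact_mod_cast hχ)
  have hH' : |(H 1 (dimP n) : ℝ)| ≤ 2 * 3 ^ D / D.factorial := by
    have := (Rat.cast_le (K := ℝ)).2 hH
    push_cast at this
    exact this
  have hα : |(alpha n : ℝ)| * |(chi n : ℝ)| = |(H 1 (dimP n) : ℝ)| * (D.factorial * K) := by
    have hχ'' : (chi n : ℝ) ≠ 0 := by exact_mod_cast hχ
    rw [← abs_mul, alpha, hN]
    push_cast
    rw [div_mul_cancel₀ _ hχ'', abs_mul, abs_of_nonneg (a := (D.factorial : ℝ) * K) (by positivity)]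
  have hK' := (mul_le_mul_of_nonneg_left (hK _ (pow_pos hy 2)) hf.le).trans hR
  have h1 : c * (1 / (D.factorial : ℝ)) * |(chi n : ℝ)| ≤
      2 * 3 ^ D / D.factorial * (D.factorial * K) := by
    calc c * (1 / (D.factorial : ℝ)) * |(chi n : ℝ)| ≤ |(alpha n : ℝ)| * |(chi n : ℝ)| := by gcongr
      _ = _ := hα
      _ ≤ _ := by gcongr
  -- The `1 / D!` of the hypothesis cancels the one in the bound for `H`, leaving the `D!` from the
  -- chain count.
  have h2 : |(chi n : ℝ)| ≤ 2 / c * (3 ^ D * (D.factorial * K)) := by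
    have : c * (1 / (D.factorial : ℝ)) * |(chi n : ℝ)| = c / D.factorial * |(chi n : ℝ)| := by ring
    rw [this] at h1
    have h3 := (le_div_iff₀' (by positivity)).2 h1
    refine h3.trans_eq ?_
    field_simp
  refine h2.trans (mul_le_mul_of_nonneg_left ?_ (by positivity))
  calc 3 ^ D * ((D.factorial : ℝ) * K) ≤ 3 ^ D * _ := mul_le_mul_of_nonneg_left hK' (by positivity)
    _ = _ := by
      rw [show (8655 : ℝ) * Real.exp 25 = 3 * (2885 * Real.exp 25) by ring, mul_pow 3]
      ring

end ZetaPoset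

theorem mainTheorem9
    (hα : ∃ c : ℝ, 0 < c ∧ ∀ᶠ n : ℕ in atTop, ZetaPoset.chi n ≠ 0 →
      c * (1 / ((ZetaPoset.dimP n + 1).factorial : ℝ)) ≤ |(ZetaPoset.alpha n : ℝ)|) :
    ∃ A : ℝ, 0 < A ∧
      (fun n : ℕ => (ZetaPoset.chi n : ℝ)) =O[atTop]
        (fun n : ℕ => (n : ℝ) *
          Real.exp (-A * (Real.log n * Real.log (Real.log (Real.log n)) /
            Real.log (Real.log n)))) := by
  obtain ⟨c, hc, hα⟩ := hα
  -- `128 = 4 · 32`: the `4` from the decay in `D`, the `32` from replacing `D log log D` by a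
  -- function of `n`.
  refine ⟨1 / 128, by norm_num, IsBigO.of_bound (2 / c) ?_⟩
  have hlog : Tendsto (fun n : ℕ => Real.log (n : ℝ)) atTop atTop :=
    Real.tendsto_log_atTop.comp tendsto_natCast_atTop_atTop
  have hdim : Tendsto (fun n => ZetaPoset.dimP n + 1) atTop atTop :=
    (tendsto_add_atTop_nat 1).comp ZetaPoset.tendsto_dimP
  filter_upwards [hα, hlog.eventually ZetaPoset.eventually_le_mul_log_log,
    hdim.eventually (ZetaPoset.eventually_nth_prime_mul_pow_div_le
      (B := 8655 * Real.exp 25) (by positivity)),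
    ZetaPoset.tendsto_dimP.eventually_ge_atTop 2, eventually_ge_atTop 1] with n hα hx hdec hd hn
  rw [Real.norm_eq_abs, Real.norm_of_nonneg (by positivity)]
  by_cases hχ : ZetaPoset.chi n = 0
  · rw [hχ, Int.cast_zero, abs_zero]
    positivity
  refine (ZetaPoset.abs_chi_le hc (by omega) hχ (hα hχ)).trans ?_
  have hx' := hx (ZetaPoset.dimP n + 1 : ℕ) (by exact_mod_cast (by omega : 3 ≤ ZetaPoset.dimP n + 1))
    (ZetaPoset.log_le_dimP hn (by omega))
  gcongr
  refine hdec.trans (Real.exp_le_exp.2 ?_)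
  linarith
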